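/- **Theorem (exact connectivity probability of a centralized antenna system with MRT).** A transmitter (Alice) with $M\ge 1$ co-located antennas at a point $\mathbb{L}_a\in\mathbb{R}^2$ at distance $r_{a,o}>0$ from the origin $o$ sends with total power $P_A>0$ to a single-antenna receiver (Bob) at $o$. The interferers are located at the points $\mathbb{L}_1,\mathbb{L}_2,\dots$ of a homogeneous Poisson point process $\Phi_J$ of density $\lambda_J>0$ on $\mathbb{R}^2$, and each of them transmits with power $P_J>0$; let $r_{j,o}=\|\mathbb{L}_j\|$. The path-loss exponent is $\alpha>2$. The fading coefficients $h_1,\dots,h_M$ (from Alice's antennas to Bob) and $h_{j,o}$ (from the $j$-th interferer to Bob), $j\ge1$, are i.i.d. standard circularly symmetric complex Gaussian $\mathcal{CN}(0,1)$ (Rayleigh fading) and independent of the locations $(\mathbb{L}_j)_j$. Alice uses maximal ratio transmission, with weights $g_m=\overline{h_m}/\|\boldsymbol h\|$, $\|\boldsymbol h\|^2=\sum_{m=1}^M|h_m|^2$. The thermal noise is neglected. The desired signal power and the aggregate interference power at Bob are $$S_o=\Big|\sum_{m=1}^M\sqrt{P_A}\,g_m h_m r_{a,o}^{-\alpha/2}\Big|^2,\qquad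 I_o=\sum_{j}P_J|h_{j,o}|^2r_{j,o}^{-\alpha}.$$ For $\beta\ge0$ let $\mathcal{C}=\mathbb{P}\{S_o/I_o\ge\beta\}$ be the connectivity probability. Put $\delta=2/\alpha$, $\kappa=\pi\,\Gamma(1+\delta)\Gamma(1-\delta)$ and $\phi=\kappa\lambda_JP_J^{\delta}r_{a,o}^2/P_A^{\delta}$. Then $$\mathcal{C}=e^{-\phi\beta^{\delta}}+e^{-\phi\beta^{\delta}}\sum_{m=1}^{M-1}\frac{1}{m!}\sum_{n=1}^{m}\left(\delta\phi\beta^{\delta}\right)^n\Upsilon_{m,n},$$ where, for $1\le n\le m$, $$\Upsilon_{m,n}=\sum_{\substack{\psi\subseteq\{1,\dots,m-1\}\\|\psi|=m-n}}\ \prod_{i=1}^{m-n}\left[l_i-\delta(l_i-i+1)\right],$$ $l_1<l_2<\dots<l_{m-n}$ being the elements of $\psi$ in ascending order; in particular $\Upsilon_{m,m}=1$ (empty product). -/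

import Mathlib

open MeasureTheory ProbabilityTheory
open scoped ENNReal NNReal

noncomputable section

namespace CAS

/-- The two-dimensional plane with its Euclidean norm. Bob sits at the origin, so the distance
`r_{x,o}` of a node at `x` to Bob is `‖x‖`. -/
abbrev Plane : Type := EuclideanSpace ℝ (Fin 2)

section PointProcess

variable {Ω E : Type*} [MeasurableSpace Ω] [MeasurableSpace E]

/-- Number (possibly infinite) of points of the configuration `{X j ω}` in the set `B`, that is
`∑ⱼ δ_{X j ω}(B)`. -/
def pointCount (X : ℕ → Ω → E) (B : Set E) (ω : Ω) : ℝ≥0∞ :=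
  Measure.sum (fun j => Measure.dirac (X j ω)) B

/-- The random points `X 0, X 1, …` form (an enumeration of) a Poisson point process with
intensity measure `Λ`: the number of points in a measurable set `B` with `Λ B < ∞` is Poisson
distributed with mean `Λ B`, and the numbers of points in pairwise disjoint measurable sets are
independent. The points are enumerated by `ℕ`, which is the right index set when `Λ` has infinite
total mass, since there are then almost surely infinitely many of them. -/
structure IsPoissonPointProcess (X : ℕ → Ω → E) (Λ : Measure E) (μ : Measure Ω) : Prop where
  measurable : ∀ j, Measurable (X j)
  law : ∀ B : Set E, MeasurableSet B → Λ B ≠ ∞ →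
    HasLaw (pointCount X B)
      ((poissonMeasure (Λ B).toNNReal).map (fun k : ℕ => (k : ℝ≥0∞))) μ
  indep : ∀ (k : ℕ) (B : Fin k → Set E), (∀ i, MeasurableSet (B i)) →
    Pairwise (fun i j => Disjoint (B i) (B j)) → iIndepFun (fun i => pointCount X (B i)) μ

end PointProcess

/-- The standard circularly symmetric complex Gaussian law `CN(0,1)`: real and imaginary parts are
independent real Gaussians with mean `0` and variance `1/2` (Rayleigh fading with unit variance). -/
def complexGaussian : Measure ℂ :=
  ((gaussianReal 0 (1 / 2)).prod (gaussianReal 0 (1 / 2))).map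
    (fun p : ℝ × ℝ => (⟨p.1, p.2⟩ : ℂ))

/-- The random network seen from Bob: `hA m` is the fading coefficient from Alice's `m`-th antenna,
`X j` the location of the `j`-th interferer and `hJ j` the fading coefficient from it. All fading
coefficients are i.i.d. `CN(0,1)`, the interferers form a homogeneous Poisson point process of
density `lam` on the whole plane, and the fading is independent of the locations. -/
structure IsNetwork {Ω : Type*} [MeasurableSpace Ω] (μ : Measure Ω) {M : ℕ}
    (hA : Fin M → Ω → ℂ) (X : ℕ → Ω → Plane) (hJ : ℕ → Ω → ℂ) (lam : ℝ≥0) : Prop where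
  measurable_hA : ∀ m, Measurable (hA m)
  measurable_hJ : ∀ j, Measurable (hJ j)
  law_hA : ∀ m, HasLaw (hA m) complexGaussian μ
  law_hJ : ∀ j, HasLaw (hJ j) complexGaussian μ
  indep_fading : iIndepFun (fun i : Fin M ⊕ ℕ => Sum.elim hA hJ i) μ
  poisson : IsPoissonPointProcess X (lam • (volume : Measure Plane)) μ
  indep_locations :
    IndepFun (fun ω (i : Fin M ⊕ ℕ) => Sum.elim hA hJ i ω) (fun ω (j : ℕ) => X j ω) μ

/-- Maximal ratio transmission: the weight of the `m`-th antenna is `h_m† / ‖h‖`, with the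
Euclidean norm of the fading vector `h`. -/
def mrtWeight {M : ℕ} (h : Fin M → ℂ) (m : Fin M) : ℂ :=
  (starRingEnd ℂ) (h m) / ((‖WithLp.toLp 2 h‖ : ℝ) : ℂ)

/-- Power of the desired signal at Bob, `|∑ₘ √Pₘ gₘ hₘ rₘ^{-α/2}|²`, for antennas at the positions
`L m` with powers `P m`, weights `g m` and fading coefficients `h m`. -/
def signalPower {M : ℕ} (α : ℝ) (P : Fin M → ℝ) (L : Fin M → Plane) (g h : Fin M → ℂ) : ℝ :=
  ‖∑ m, ((Real.sqrt (P m) : ℝ) : ℂ) * g m * h m * ((‖L m‖ ^ (-α / 2) : ℝ) : ℂ)‖ ^ 2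

/-- Aggregate interference power at Bob, `∑ⱼ P_J |h_j|² r_j^{-α}`, from interferers at the
positions `x j` with fading coefficients `h j`. -/
def interference (α PJ : ℝ) (x : ℕ → Plane) (h : ℕ → ℂ) : ℝ≥0∞ :=
  ∑' j, ENNReal.ofReal (PJ * ‖h j‖ ^ 2 * ‖x j‖ ^ (-α))

/-- Signal-to-interference-plus-noise ratio. -/
def sinr (S : ℝ) (I : ℝ≥0∞) (noise : ℝ) : ℝ≥0∞ :=
  ENNReal.ofReal S / (I + ENNReal.ofReal noise)

/-- Connectivity probability of the centralized antenna system: all antennas at `La`, maximal ratio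
transmission with total power `PA`, thermal noise of variance `noise`, SINR threshold `β`. -/
def connectivityProbability {Ω : Type*} [MeasurableSpace Ω] (μ : Measure Ω) {M : ℕ}
    (hA : Fin M → Ω → ℂ) (X : ℕ → Ω → Plane) (hJ : ℕ → Ω → ℂ)
    (α PA PJ : ℝ) (La : Plane) (noise β : ℝ) : ℝ :=
  μ.real {ω | ENNReal.ofReal β ≤
    sinr
      (signalPower α (fun _ => PA) (fun _ => La)
        (mrtWeight (fun m => hA m ω)) (fun m => hA m ω))
      (interference α PJ (fun j => X j ω) (fun j => hJ j ω))
      noise}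

/-- `κ = π Γ(1+δ) Γ(1-δ)`. -/
def kappa (δ : ℝ) : ℝ := Real.pi * Real.Gamma (1 + δ) * Real.Gamma (1 - δ)

/-- `φ = κ λ_J P_J^δ r² / P_A^δ`. -/
def phi (δ lam PJ PA r : ℝ) : ℝ := kappa δ * lam * PJ ^ δ * r ^ 2 / PA ^ δ

/-- The position of `l` in the finite set `ψ` arranged in ascending order, counted from `1`: a member
`l` of `ψ` is the `i`-th smallest one exactly if `i = #{k ∈ ψ | k ≤ l}`. -/
def position (ψ : Finset ℕ) (l : ℕ) : ℕ := (ψ.filter (fun k => k ≤ l)).card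

/-- `Υ_{m,n}` for `1 ≤ n ≤ m`: the sum over all subsets `ψ = {l_1 < l_2 < … }` of `{1, …, m-1}` of
cardinality `m-n` of the product over `i = 1, …, m-n` of `l_i - δ (l_i - i + 1)`.
For `n = m` the only such subset is empty and the value is `1`. -/
def Upsilon (δ : ℝ) (m n : ℕ) : ℝ :=
  ∑ ψ ∈ (Finset.Icc 1 (m - 1)).powersetCard (m - n),
    ∏ l ∈ ψ, ((l : ℝ) - δ * ((l : ℝ) - (position ψ l : ℝ) + 1))

end CAS

end

noncomputable section

namespace CAS

section Laplace

/-- The function `x ↦ e^{-x}` on `[0, ∞]`, with `e^{-∞} = 0`. -/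
def expNeg (x : ℝ≥0∞) : ℝ≥0∞ := EReal.exp (-(x : EReal))

lemma continuous_expNeg : Continuous expNeg :=
  ENNReal.continuous_exp.comp (continuous_neg.comp continuous_coe_ennreal_ereal)

lemma measurable_expNeg : Measurable expNeg := continuous_expNeg.measurable

lemma antitone_expNeg : Antitone expNeg := fun x y h =>
  EReal.exp_monotone (EReal.neg_le_neg_iff.2 (by exact_mod_cast h))

@[simp] lemma expNeg_zero : expNeg 0 = 1 := by simp [expNeg]

@[simp] lemma expNeg_top : expNeg ∞ = 0 := by simp [expNeg]

lemma expNeg_le_one (x : ℝ≥0∞) : expNeg x ≤ 1 := by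
  simpa using antitone_expNeg (zero_le (a := x))

lemma expNeg_ofReal {x : ℝ} (hx : 0 ≤ x) :
    expNeg (ENNReal.ofReal x) = ENNReal.ofReal (Real.exp (-x)) := by
  rw [expNeg, EReal.coe_ennreal_ofReal, max_eq_left hx, ← EReal.coe_neg, EReal.exp_coe]

lemma expNeg_of_ne_top {x : ℝ≥0∞} (hx : x ≠ ∞) :
    expNeg x = ENNReal.ofReal (Real.exp (-x.toReal)) := by
  rw [← expNeg_ofReal ENNReal.toReal_nonneg, ENNReal.ofReal_toReal hx]

lemma expNeg_add (x y : ℝ≥0∞) : expNeg (x + y) = expNeg x * expNeg y := by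
  rcases eq_or_ne x ∞ with rfl | hx
  · simp
  rcases eq_or_ne y ∞ with rfl | hy
  · simp
  rw [expNeg_of_ne_top hx, expNeg_of_ne_top hy, expNeg_of_ne_top (by simp [hx, hy]),
    ENNReal.toReal_add hx hy, neg_add, Real.exp_add, ENNReal.ofReal_mul (Real.exp_nonneg _)]

lemma expNeg_sum {ι : Type*} (s : Finset ι) (f : ι → ℝ≥0∞) :
    expNeg (∑ i ∈ s, f i) = ∏ i ∈ s, expNeg (f i) := by
  classical
  induction s using Finset.induction_on with
  | empty => simp
  | insert a s ha ih => rw [Finset.sum_insert ha, Finset.prod_insert ha, expNeg_add, ih]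

lemma expNeg_mul_natCast (c : ℝ≥0∞) (n : ℕ) : expNeg (c * n) = expNeg c ^ n := by
  simpa [mul_comm] using expNeg_sum (Finset.range n) fun _ => c

/-- The probability generating function of the Poisson law. -/
lemma lintegral_pow_poissonMeasure (r : ℝ≥0) {z : ℝ≥0∞} (hz : z ≤ 1) :
    ∫⁻ n, z ^ n ∂(poissonMeasure r) = expNeg (r * (1 - z)) := by
  have hz' : z ≠ ∞ := (hz.trans_lt (by simp)).ne
  set q := z.toReal
  have hq0 : 0 ≤ q := ENNReal.toReal_nonneg
  have hq1 : q ≤ 1 := ENNReal.toReal_le_of_le_ofReal zero_le_one (by simpa using hz)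
  have hzq : z = ENNReal.ofReal q := (ENNReal.ofReal_toReal hz').symm
  have hs : HasSum (fun n : ℕ => Real.exp (-r) * r ^ n / n.factorial * q ^ n)
      (Real.exp (-(r * (1 - q)))) := by
    have h1 := (NormedSpace.expSeries_div_hasSum_exp ((r : ℝ) * q)).mul_left (Real.exp (-r))
    rw [← Real.exp_eq_exp_ℝ, ← Real.exp_add] at h1
    rw [show -((r : ℝ) * (1 - q)) = -r + r * q by ring]
    have e : (fun n : ℕ => Real.exp (-r) * r ^ n / n.factorial * q ^ n) =
        fun n => Real.exp (-r) * ((r * q) ^ n / n.factorial) := by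
      ext n
      rw [mul_pow]
      ring
    rw [e]
    exact h1
  rw [poissonMeasure, lintegral_sum_measure]
  simp_rw [lintegral_smul_measure, lintegral_dirac, hzq, ← ENNReal.ofReal_pow hq0, smul_eq_mul]
  rw [← ENNReal.ofReal_one, ← ENNReal.ofReal_sub _ hq0, ← ENNReal.ofReal_coe_nnreal,
    ← ENNReal.ofReal_mul r.coe_nonneg,
    expNeg_ofReal (mul_nonneg r.coe_nonneg (sub_nonneg.2 hq1)), ← hs.tsum_eq,
    ENNReal.ofReal_tsum_of_nonneg (fun n => by positivity) hs.summable]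
  refine tsum_congr fun n => ?_
  rw [ENNReal.ofReal_mul (by positivity)]

lemma measurable_pointCount {Ω E : Type*} [MeasurableSpace Ω] [MeasurableSpace E]
    {X : ℕ → Ω → E} (hX : ∀ j, Measurable (X j)) {B : Set E} (hB : MeasurableSet B) :
    Measurable (pointCount X B) := by
  have : pointCount X B = fun ω => ∑' j, B.indicator 1 (X j ω) := by
    ext ω
    simp [pointCount, Measure.sum_apply _ hB, Measure.dirac_apply' _ hB]
  rw [this]
  exact Measurable.tsum fun j => (measurable_one.indicator hB).comp (hX j)

variable {Ω E : Type*} [MeasurableSpace Ω] [MeasurableSpace E]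

lemma IsPoissonPointProcess.lintegral_expNeg_mul_pointCount {X : ℕ → Ω → E} {Λ : Measure E}
    {μ : Measure Ω} (h : IsPoissonPointProcess X Λ μ) {B : Set E} (hB : MeasurableSet B)
    (hΛ : Λ B ≠ ∞) (c : ℝ≥0∞) :
    ∫⁻ ω, expNeg (c * pointCount X B ω) ∂μ = expNeg ((1 - expNeg c) * Λ B) := by
  have hm : Measurable fun x : ℝ≥0∞ => expNeg (c * x) :=
    measurable_expNeg.comp (measurable_id.const_mul c)
  rw [(h.law B hB hΛ).lintegral_comp hm.aemeasurable, lintegral_map hm (by fun_prop)]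
  simp_rw [expNeg_mul_natCast]
  rw [lintegral_pow_poissonMeasure _ (expNeg_le_one c), ENNReal.coe_toNNReal hΛ, mul_comm]

lemma IsPoissonPointProcess.lintegral_expNeg_simpleFunc {X : ℕ → Ω → E} {Λ : Measure E}
    {μ : Measure Ω} (h : IsPoissonPointProcess X Λ μ) (f : SimpleFunc E ℝ≥0∞)
    (hf : f.FinMeasSupp Λ) :
    ∫⁻ ω, expNeg (∫⁻ x, f x ∂(Measure.sum fun j => Measure.dirac (X j ω))) ∂μ =
      expNeg (∫⁻ x, (1 - expNeg (f x)) ∂Λ) := by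
  classical
  set s : Finset ℝ≥0∞ := f.range.filter (· ≠ 0) with hs
  have key : ∀ (g : ℝ≥0∞ → ℝ≥0∞), g 0 = 0 → ∀ ν : Measure E,
      ∫⁻ x, g (f x) ∂ν = ∑ c ∈ s, g c * ν (f ⁻¹' {c}) := by
    intro g hg ν
    have := SimpleFunc.map_lintegral g f (μ := ν)
    rw [← SimpleFunc.lintegral_eq_lintegral] at this
    simp only [SimpleFunc.coe_map, Function.comp_apply] at this
    rw [this, hs, Finset.sum_filter_of_ne]
    rintro c - hc rfl
    simp [hg] at hc
  have hind : iIndepFun (fun (c : s) => pointCount X (f ⁻¹' {(c : ℝ≥0∞)})) μ := by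
    have h1 := h.indep s.card (fun i => f ⁻¹' {(s.equivFin.symm i : ℝ≥0∞)})
      (fun i => f.measurableSet_fiber _) (fun i j hij => by
        refine Disjoint.preimage _ ?_
        simpa [Subtype.val_inj] using hij)
    have h2 := h1.precomp s.equivFin.injective
    simpa using h2
  have hid := key id rfl
  simp only [id] at hid
  simp_rw [hid, expNeg_sum]
  rw [key (fun c => 1 - expNeg c) (by simp) Λ, expNeg_sum]
  have h3 : ∀ c ∈ s, ∫⁻ ω, expNeg (c * pointCount X (f ⁻¹' {c}) ω) ∂μ =
      expNeg ((1 - expNeg c) * Λ (f ⁻¹' {c})) := fun c hc =>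
    h.lintegral_expNeg_mul_pointCount (f.measurableSet_fiber _)
      (hf.meas_preimage_singleton_ne_zero (by simpa [hs] using (Finset.mem_filter.1 hc).2)).ne c
  rw [← Finset.prod_coe_sort s (fun c => expNeg ((1 - expNeg c) * Λ (f ⁻¹' {c})))]
  rw [← Finset.prod_congr rfl (fun (c : s) _ => h3 c c.2)]
  have hm : ∀ c : ℝ≥0∞, Measurable fun x : ℝ≥0∞ => expNeg (c * x) := fun c =>
    measurable_expNeg.comp (measurable_id.const_mul c)
  rw [← lintegral_prod_eq_prod_lintegral_of_indepFun Finset.univ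
    (fun (c : s) ω => expNeg ((c : ℝ≥0∞) * pointCount X (f ⁻¹' {(c : ℝ≥0∞)}) ω))
    (hind.comp (fun c x => expNeg ((c : ℝ≥0∞) * x)) fun c => hm c)
    (fun c => (hm c).comp (measurable_pointCount h.measurable (f.measurableSet_fiber _)))]
  refine lintegral_congr fun ω => ?_
  rw [← Finset.prod_coe_sort s]
  rfl

/-- The Laplace functional of a Poisson point process. -/
theorem IsPoissonPointProcess.lintegral_expNeg_tsum {X : ℕ → Ω → E} {Λ : Measure E}
    [SigmaFinite Λ] {μ : Measure Ω} [IsProbabilityMeasure μ]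
    (h : IsPoissonPointProcess X Λ μ) {f : E → ℝ≥0∞}
    (hf : Measurable f) :
    ∫⁻ ω, expNeg (∑' j, f (X j ω)) ∂μ = expNeg (∫⁻ x, (1 - expNeg (f x)) ∂Λ) := by
  let g : ℕ → SimpleFunc E ℝ≥0∞ := fun n =>
    (SimpleFunc.eapprox f n).restrict (spanningSets Λ n)
  have hg : ∀ n x, g n x = (spanningSets Λ n).indicator (SimpleFunc.eapprox f n) x := fun n x =>
    SimpleFunc.restrict_apply _ (measurableSet_spanningSets Λ n) x
  have hmono : ∀ x, Monotone fun n => g n x := by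
    intro x n m hnm
    simp only [hg]
    refine (Set.indicator_le_indicator (SimpleFunc.monotone_eapprox f hnm x)).trans ?_
    exact Set.indicator_le_indicator_of_subset (monotone_spanningSets Λ hnm) (by simp) x
  have hlim : ∀ x, Filter.Tendsto (fun n => g n x) Filter.atTop (nhds (f x)) := by
    intro x
    have h1 := tendsto_atTop_iSup (f := fun n => SimpleFunc.eapprox f n x)
      fun n m hnm => SimpleFunc.monotone_eapprox f hnm x
    rw [SimpleFunc.iSup_eapprox_apply hf] at h1
    refine h1.congr' ?_
    filter_upwards [Filter.eventually_ge_atTop (spanningSetsIndex Λ x)] with n hn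
    rw [hg, Set.indicator_of_mem (mem_spanningSets_of_index_le Λ x hn)]
  have hsupp : ∀ n, (g n).FinMeasSupp Λ := by
    intro n
    rw [SimpleFunc.finMeasSupp_iff_support]
    refine (measure_mono ?_).trans_lt (measure_spanningSets_lt_top Λ n)
    intro x hx
    by_contra hx'
    exact hx (by rw [hg, Set.indicator_of_notMem hx'])
  have hsum : ∀ ω, ∑' j, f (X j ω) = ∫⁻ x, f x ∂(Measure.sum fun j => Measure.dirac (X j ω)) := by
    intro ω
    rw [lintegral_sum_measure]
    simp_rw [lintegral_dirac' _ hf]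
  have hL : Filter.Tendsto (fun n => ∫⁻ ω, expNeg (∫⁻ x, g n x
      ∂(Measure.sum fun j => Measure.dirac (X j ω))) ∂μ) Filter.atTop
      (nhds (∫⁻ ω, expNeg (∑' j, f (X j ω)) ∂μ)) := by
    refine tendsto_lintegral_of_dominated_convergence (fun _ => 1) (fun n => ?_)
      (fun n => Filter.Eventually.of_forall fun ω => expNeg_le_one _) (by simp)
      (Filter.Eventually.of_forall fun ω => ?_)
    · refine measurable_expNeg.comp ?_
      simp_rw [lintegral_sum_measure, lintegral_dirac' _ (g n).measurable]
      exact Measurable.tsum fun j => (g n).measurable.comp (h.measurable j)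
    · rw [hsum]
      exact (continuous_expNeg.tendsto _).comp (lintegral_tendsto_of_tendsto_of_monotone
        (fun n => (g n).measurable.aemeasurable) (Filter.Eventually.of_forall hmono)
        (Filter.Eventually.of_forall hlim))
  have hR : Filter.Tendsto (fun n => expNeg (∫⁻ x, (1 - expNeg (g n x)) ∂Λ)) Filter.atTop
      (nhds (expNeg (∫⁻ x, (1 - expNeg (f x)) ∂Λ))) := by
    refine (continuous_expNeg.tendsto _).comp (lintegral_tendsto_of_tendsto_of_monotone
        (fun n => ((measurable_expNeg.comp (g n).measurable).const_sub 1).aemeasurable)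
        (Filter.Eventually.of_forall fun x n m hnm =>
          tsub_le_tsub_left (antitone_expNeg (hmono x hnm)) 1)
        (Filter.Eventually.of_forall fun x => ?_))
    exact ENNReal.Tendsto.sub tendsto_const_nhds
      ((continuous_expNeg.tendsto _).comp (hlim x)) (by simp)
  refine tendsto_nhds_unique hL (hR.congr fun n => ?_)
  rw [h.lintegral_expNeg_simpleFunc (g n) (hsupp n)]

end Laplace

section Fading

lemma complexGaussian_eq_withDensity :
    complexGaussian =
      (volume : Measure ℂ).withDensity fun z =>
        ENNReal.ofReal (Real.pi⁻¹ * Real.exp (-‖z‖ ^ 2)) := by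
  have hmeas : Measurable fun p : ℝ × ℝ => (⟨p.1, p.2⟩ : ℂ) :=
    Complex.measurableEquivRealProd.symm.measurable
  have hd : Measurable fun z : ℂ => ENNReal.ofReal (Real.pi⁻¹ * Real.exp (-‖z‖ ^ 2)) := by
    fun_prop
  refine Measure.ext_of_lintegral _ fun g hg => ?_
  rw [lintegral_withDensity_eq_lintegral_mul _ hd hg, complexGaussian, lintegral_map hg hmeas,
    gaussianReal_of_var_ne_zero 0 (by norm_num : (1 / 2 : ℝ≥0) ≠ 0),
    prod_withDensity (measurable_gaussianPDF _ _) (measurable_gaussianPDF _ _),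
    lintegral_withDensity_eq_lintegral_mul _ (by fun_prop)
      (g := fun p : ℝ × ℝ => g ⟨p.1, p.2⟩) (hg.comp hmeas),
    ← (Complex.volume_preserving_equiv_real_prod.symm).lintegral_comp (by fun_prop)]
  refine lintegral_congr fun p => ?_
  simp only [Pi.mul_apply]
  congr 1
  rw [gaussianPDF, gaussianPDF, ← ENNReal.ofReal_mul (gaussianPDFReal_nonneg _ _ _)]
  congr 1
  rw [gaussianPDFReal, gaussianPDFReal, Complex.sq_norm, Complex.normSq_apply]
  simp only [Complex.measurableEquivRealProd_symm_apply]
  have h1 : (√(2 * Real.pi * ((1 / 2 : ℝ≥0) : ℝ)))⁻¹ * (√(2 * Real.pi * ((1 / 2 : ℝ≥0) : ℝ)))⁻¹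
      = Real.pi⁻¹ := by
    rw [← mul_inv, Real.mul_self_sqrt (by positivity)]
    push_cast
    congr 1
    ring
  rw [mul_mul_mul_comm, h1, ← Real.exp_add]
  congr 2
  push_cast
  ring

lemma integral_norm_sq_complexGaussian (f : ℝ → ℝ) :
    ∫ z, f (‖z‖ ^ 2) ∂complexGaussian = ∫ y in Set.Ioi 0, Real.exp (-y) * f y := by
  rw [complexGaussian_eq_withDensity, integral_withDensity_eq_integral_toReal_smul (by fun_prop)
    (by simp)]
  have h := integral_fun_norm_addHaar (volume : Measure ℂ)
    (fun r => (Real.pi⁻¹ * Real.exp (-r ^ 2)) * f (r ^ 2))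
  have hv : (volume : Measure ℂ).real (Metric.ball 0 1) = Real.pi := by
    simp [measureReal_def, Complex.volume_ball]
  rw [hv, Complex.finrank_real_complex] at h
  have e : ∀ z : ℂ, (ENNReal.ofReal (Real.pi⁻¹ * Real.exp (-‖z‖ ^ 2))).toReal • f (‖z‖ ^ 2) =
      (Real.pi⁻¹ * Real.exp (-‖z‖ ^ 2)) * f (‖z‖ ^ 2) := fun z => by
    rw [ENNReal.toReal_ofReal (by positivity), smul_eq_mul]
  simp_rw [e]
  rw [h, ← integral_comp_rpow_Ioi (fun y => Real.exp (-y) * f y) (p := 2) (by norm_num),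
    nsmul_eq_mul, smul_eq_mul, ← integral_const_mul, ← integral_const_mul]
  refine setIntegral_congr_fun measurableSet_Ioi fun r hr => ?_
  simp only [smul_eq_mul]
  norm_num
  field_simp

/-- The standard exponential law. -/
def unitExp : Measure ℝ :=
  (volume.restrict (Set.Ioi 0)).withDensity fun y => ENNReal.ofReal (Real.exp (-y))

instance : IsProbabilityMeasure complexGaussian :=
  Measure.isProbabilityMeasure_map (Complex.measurableEquivRealProd.symm.measurable.aemeasurable)

/-- The squared modulus of a standard complex Gaussian variable is exponentially distributed. -/
lemma map_norm_sq_complexGaussian :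
    complexGaussian.map (fun z => ‖z‖ ^ 2) = unitExp := by
  have hm : Measurable fun z : ℂ => ‖z‖ ^ 2 := by fun_prop
  ext s hs
  have h := integral_norm_sq_complexGaussian (s.indicator 1)
  have e1 : ∀ z : ℂ, s.indicator (1 : ℝ → ℝ) (‖z‖ ^ 2) =
      ((fun z : ℂ => ‖z‖ ^ 2) ⁻¹' s).indicator 1 z := fun z => rfl
  simp_rw [e1] at h
  rw [integral_indicator_one (hm hs)] at h
  have e2 : ∀ y : ℝ, Real.exp (-y) * s.indicator (1 : ℝ → ℝ) y =
      s.indicator (fun y => Real.exp (-y)) y := fun y => by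
    by_cases hy : y ∈ s <;> simp [hy]
  simp_rw [e2] at h
  rw [integral_indicator hs] at h
  rw [Measure.map_apply hm hs, unitExp, withDensity_apply _ hs,
    ← ofReal_integral_eq_lintegral_ofReal, ← h, ofReal_measureReal]
  · refine Integrable.restrict ?_
    exact integrableOn_exp_neg_Ioi 0
  · exact Filter.Eventually.of_forall fun y => (Real.exp_pos _).le

lemma lintegral_unitExp {g : ℝ → ℝ≥0∞} (hg : Measurable g) :
    ∫⁻ y, g y ∂unitExp = ∫⁻ y in Set.Ioi 0, ENNReal.ofReal (Real.exp (-y)) * g y := by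
  rw [unitExp, lintegral_withDensity_eq_lintegral_mul _ (by fun_prop) hg]
  rfl

lemma lintegral_expNeg_mul_norm_sq_complexGaussian {a : ℝ} (ha : 0 ≤ a) :
    ∫⁻ z, expNeg (ENNReal.ofReal (a * ‖z‖ ^ 2)) ∂complexGaussian =
      expNeg (ENNReal.ofReal (Real.log (1 + a))) := by
  have h := integral_norm_sq_complexGaussian fun y => Real.exp (-(a * y))
  have h1 : ∫ y in Set.Ioi (0 : ℝ), Real.exp (-y) * Real.exp (-(a * y)) = (1 + a)⁻¹ := by
    have := integral_exp_mul_Ioi (a := -(1 + a)) (by linarith) 0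
    simp_rw [← Real.exp_add]
    convert this using 1
    · congr 1
      ext y
      congr 1
      ring
    · rw [mul_zero, Real.exp_zero, neg_div_neg_eq, one_div]
  rw [h1] at h
  simp_rw [fun z : ℂ => expNeg_ofReal (x := a * ‖z‖ ^ 2) (by positivity)]
  rw [expNeg_ofReal (Real.log_nonneg (by linarith)), Real.exp_neg, Real.exp_log (by linarith), ← h,
    ofReal_integral_eq_lintegral_ofReal]
  · exact Integrable.of_integral_ne_zero (by rw [h]; positivity)
  · exact Filter.Eventually.of_forall fun y => (Real.exp_pos _).le

lemma lintegral_expNeg_tsum_norm_sq {Ω : Type*} [MeasurableSpace Ω] {μ : Measure Ω}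
    [IsProbabilityMeasure μ] {h : ℕ → Ω → ℂ} (hm : ∀ j, Measurable (h j))
    (hlaw : ∀ j, HasLaw (h j) complexGaussian μ) (hind : iIndepFun h μ)
    {a : ℕ → ℝ} (ha : ∀ j, 0 ≤ a j) :
    ∫⁻ ω, expNeg (∑' j, ENNReal.ofReal (a j * ‖h j ω‖ ^ 2)) ∂μ =
      expNeg (∑' j, ENNReal.ofReal (Real.log (1 + a j))) := by
  have hfm : ∀ j, Measurable fun z : ℂ => expNeg (ENNReal.ofReal (a j * ‖z‖ ^ 2)) := fun j =>
    measurable_expNeg.comp (by fun_prop)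
  have hfin : ∀ n, ∫⁻ ω, expNeg (∑ j ∈ Finset.range n, ENNReal.ofReal (a j * ‖h j ω‖ ^ 2)) ∂μ =
      expNeg (∑ j ∈ Finset.range n, ENNReal.ofReal (Real.log (1 + a j))) := by
    intro n
    simp_rw [expNeg_sum]
    rw [lintegral_prod_eq_prod_lintegral_of_indepFun (Finset.range n)
      (fun j ω => expNeg (ENNReal.ofReal (a j * ‖h j ω‖ ^ 2)))
      (hind.comp (fun j z => expNeg (ENNReal.ofReal (a j * ‖z‖ ^ 2))) hfm)
      (fun j => (hfm j).comp (hm j))]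
    refine Finset.prod_congr rfl fun j _ => ?_
    rw [← lintegral_expNeg_mul_norm_sq_complexGaussian (ha j),
      ← (hlaw j).lintegral_comp (hfm j).aemeasurable]
  have hL : Filter.Tendsto
      (fun n => ∫⁻ ω, expNeg (∑ j ∈ Finset.range n, ENNReal.ofReal (a j * ‖h j ω‖ ^ 2)) ∂μ)
      Filter.atTop (nhds (∫⁻ ω, expNeg (∑' j, ENNReal.ofReal (a j * ‖h j ω‖ ^ 2)) ∂μ)) := by
    refine tendsto_lintegral_of_dominated_convergence (fun _ => 1) (fun n => ?_)
      (fun n => Filter.Eventually.of_forall fun ω => expNeg_le_one _) (by simp)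
      (Filter.Eventually.of_forall fun ω => ?_)
    · exact measurable_expNeg.comp (Finset.measurable_fun_sum _ fun j _ => by fun_prop)
    · exact (continuous_expNeg.tendsto _).comp (ENNReal.tendsto_nat_tsum _)
  have hR := (continuous_expNeg.tendsto _).comp
    (ENNReal.tendsto_nat_tsum fun j => ENNReal.ofReal (Real.log (1 + a j)))
  exact tendsto_nhds_unique hL (hR.congr fun n => (hfin n).symm)

end Fading

section PathLoss

lemma lintegral_exp_neg_mul_norm_rpow {α v : ℝ} (hα : 0 < α) (hv : 0 < v) :
    ∫⁻ x : Plane, ENNReal.ofReal (Real.exp (-v * ‖x‖ ^ α)) =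
      ENNReal.ofReal (Real.pi * Real.Gamma (1 + 2 / α) * v ^ (-(2 / α))) := by
  have h := integral_fun_norm_addHaar (volume : Measure Plane)
    (fun r => Real.exp (-v * r ^ α))
  have hb : (volume : Measure Plane).real (Metric.ball 0 1) = Real.pi := by
    simp [measureReal_def, EuclideanSpace.volume_ball_fin_two, Real.pi_nonneg]
  have h1 := integral_rpow_mul_exp_neg_mul_rpow (p := α) (q := 1) (b := v) hα (by norm_num) hv
  have h2 : ∫ x : Plane, Real.exp (-v * ‖x‖ ^ α) =
      Real.pi * Real.Gamma (1 + 2 / α) * v ^ (-(2 / α)) := by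
    rw [h, hb, finrank_euclideanSpace_fin]
    simp only [Real.rpow_one] at h1
    simp only [Nat.add_one_sub_one, pow_one, smul_eq_mul, nsmul_eq_mul]
    rw [h1, add_comm 1 (2 / α), Real.Gamma_add_one (by positivity)]
    norm_num
    rw [neg_div]
    ring
  rw [← h2, ofReal_integral_eq_lintegral_ofReal]
  · refine Integrable.of_integral_ne_zero ?_
    rw [h2]
    have := Real.Gamma_pos_of_pos (show 0 < 1 + 2 / α by positivity)
    positivity
  · exact Filter.Eventually.of_forall fun y => (Real.exp_pos _).le

lemma lintegral_path_loss {α s : ℝ} (hα : 2 < α) (hs : 0 < s) :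
    ∫⁻ x : Plane, (1 - expNeg (ENNReal.ofReal (Real.log (1 + s * ‖x‖ ^ (-α))))) =
      ENNReal.ofReal (kappa (2 / α) * s ^ (2 / α)) := by
  have hα0 : 0 < α := by linarith
  have hδ1 : 2 / α < 1 := by rw [div_lt_one hα0]; exact hα
  have hpt : ∀ᵐ x : Plane, 1 - expNeg (ENNReal.ofReal (Real.log (1 + s * ‖x‖ ^ (-α)))) =
      ∫⁻ v in Set.Ioi (0 : ℝ), ENNReal.ofReal (s * Real.exp (-s * v)) *
        ENNReal.ofReal (Real.exp (-v * ‖x‖ ^ α)) := by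
    have : ∀ᵐ x : Plane, x ≠ 0 := by simp [ae_iff]
    filter_upwards [this] with x hx
    have hr : 0 < ‖x‖ := norm_pos_iff.2 hx
    have hrα : 0 < ‖x‖ ^ α := Real.rpow_pos_of_pos hr _
    have hrα' : 0 < ‖x‖ ^ (-α) := Real.rpow_pos_of_pos hr _
    rw [expNeg_ofReal (Real.log_nonneg (by nlinarith [mul_pos hs hrα'])), Real.exp_neg,
      Real.exp_log (by positivity), ← ENNReal.ofReal_one, ← ENNReal.ofReal_sub _ (by positivity)]
    have h1 := integral_exp_mul_Ioi (a := -(s + ‖x‖ ^ α)) (by linarith) 0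
    have h2 : ∫ v in Set.Ioi (0 : ℝ), s * Real.exp (-s * v) * Real.exp (-v * ‖x‖ ^ α) =
        1 - (1 + s * ‖x‖ ^ (-α))⁻¹ := by
      have e : ∀ v : ℝ, s * Real.exp (-s * v) * Real.exp (-v * ‖x‖ ^ α) =
          s * Real.exp (-(s + ‖x‖ ^ α) * v) := fun v => by
        rw [mul_assoc, ← Real.exp_add]
        congr 2
        ring
      simp_rw [e]
      rw [integral_const_mul, h1, Real.rpow_neg hr.le]
      simp only [mul_zero, Real.exp_zero]
      field_simp
      ring
    simp_rw [fun v : ℝ => (ENNReal.ofReal_mul (p := s * Real.exp (-s * v))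
      (q := Real.exp (-v * ‖x‖ ^ α)) (by positivity)).symm]
    rw [← ofReal_integral_eq_lintegral_ofReal, h2]
    · refine Integrable.of_integral_ne_zero ?_
      rw [h2]
      have : (1 + s * ‖x‖ ^ (-α))⁻¹ < 1 := inv_lt_one_of_one_lt₀ (by nlinarith [mul_pos hs hrα'])
      linarith
    · exact Filter.Eventually.of_forall fun y => by positivity
  have hG : 0 < Real.Gamma (1 + 2 / α) := Real.Gamma_pos_of_pos (by positivity)
  rw [lintegral_congr_ae hpt, lintegral_lintegral_swap (by fun_prop)]
  have hin : ∀ v ∈ Set.Ioi (0 : ℝ), ∫⁻ x : Plane, ENNReal.ofReal (s * Real.exp (-s * v)) *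
        ENNReal.ofReal (Real.exp (-v * ‖x‖ ^ α)) =
      ENNReal.ofReal (s * Real.pi * Real.Gamma (1 + 2 / α) *
        (v ^ (-(2 / α)) * Real.exp (-s * v ^ (1 : ℝ)))) := by
    intro v hv
    rw [lintegral_const_mul _ (by fun_prop), lintegral_exp_neg_mul_norm_rpow hα0 hv,
      ← ENNReal.ofReal_mul (by positivity), Real.rpow_one]
    congr 1
    ring
  rw [setLIntegral_congr_fun measurableSet_Ioi hin]
  have h3 := integral_rpow_mul_exp_neg_mul_rpow (p := 1) (q := -(2 / α)) (b := s) one_pos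
    (by linarith) hs
  rw [← ofReal_integral_eq_lintegral_ofReal, integral_const_mul, h3]
  · congr 1
    rw [kappa, div_one, div_one, show -(-(2 / α) + 1) = 2 / α - 1 by ring, Real.rpow_sub_one hs.ne',
      show -(2 / α) + 1 = 1 - 2 / α by ring]
    field_simp
  · exact (integrableOn_rpow_mul_exp_neg_mul_rpow (by linarith) one_pos hs).const_mul _
  · filter_upwards [ae_restrict_mem measurableSet_Ioi] with v hv
    have : 0 < v := hv
    positivity

end PathLoss

section GammaTail

/-- The tail function of the Gamma law of integer shape `k` and unit rate. -/
def gammaTail (k : ℕ) (y : ℝ) : ℝ :=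
  Real.exp (-y) * ∑ m ∈ Finset.range k, y ^ m / m.factorial

lemma gammaTail_nonneg (k : ℕ) {y : ℝ} (hy : 0 ≤ y) : 0 ≤ gammaTail k y :=
  mul_nonneg (Real.exp_nonneg _) (Finset.sum_nonneg fun m _ => by positivity)

lemma continuous_gammaTail (k : ℕ) : Continuous (gammaTail k) := by
  unfold gammaTail
  fun_prop

lemma gammaTail_zero {k : ℕ} (hk : 1 ≤ k) : gammaTail k 0 = 1 := by
  obtain ⟨k, rfl⟩ := Nat.exists_eq_add_of_le' hk
  simp [gammaTail, Finset.sum_range_succ']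

lemma integral_exp_neg_mul_gammaTail (k : ℕ) (y : ℝ) :
    ∫ w in (0 : ℝ)..y, Real.exp (-w) * gammaTail k (y - w) =
      gammaTail (k + 1) y - Real.exp (-y) := by
  have e : ∀ w : ℝ, Real.exp (-w) * gammaTail k (y - w) =
      Real.exp (-y) * ∑ m ∈ Finset.range k, (y - w) ^ m / m.factorial := fun w => by
    rw [gammaTail, ← mul_assoc, ← Real.exp_add]
    congr 2
    ring
  simp_rw [e]
  rw [intervalIntegral.integral_const_mul, intervalIntegral.integral_finsetSum
    (fun m _ => (by fun_prop : Continuous fun w : ℝ => (y - w) ^ m / (m.factorial : ℝ))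
      |>.intervalIntegrable _ _),
    gammaTail, Finset.sum_range_succ']
  have h : ∀ m : ℕ, ∫ w in (0 : ℝ)..y, (y - w) ^ m / (m.factorial : ℝ) =
      y ^ (m + 1) / ((m + 1).factorial : ℝ) := fun m => by
    rw [intervalIntegral.integral_div, intervalIntegral.integral_comp_sub_left (fun w => w ^ m) y,
      sub_self, sub_zero, integral_pow, Nat.factorial_succ]
    push_cast
    field_simp
    simp
  simp_rw [h]
  simp
  ring

variable {Ω : Type*} [MeasurableSpace Ω] {μ : Measure Ω} [IsProbabilityMeasure μ]

lemma measure_le_add_of_indepFun {W S : Ω → ℝ} (hW : Measurable W) (hS : Measurable S)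
    (hlaw : μ.map W = unitExp) (hind : IndepFun W S μ) (hS0 : ∀ ω, 0 ≤ S ω) {k : ℕ}
    (htail : ∀ y, 0 < y → μ {ω | y ≤ S ω} = ENNReal.ofReal (gammaTail k y)) {y : ℝ} (hy : 0 < y) :
    μ {ω | y ≤ W ω + S ω} = ENNReal.ofReal (gammaTail (k + 1) y) := by
  have hset : MeasurableSet {p : ℝ × ℝ | y ≤ p.1 + p.2} :=
    measurableSet_le measurable_const (by fun_prop)
  have h1 : μ {ω | y ≤ W ω + S ω} = (μ.map fun ω => (W ω, S ω)) {p : ℝ × ℝ | y ≤ p.1 + p.2} := by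
    rw [Measure.map_apply (hW.prodMk hS) hset]
    rfl
  have : IsProbabilityMeasure (μ.map S) := Measure.isProbabilityMeasure_map hS.aemeasurable
  rw [h1, (indepFun_iff_map_prod_eq_prod_map_map hW.aemeasurable hS.aemeasurable).1 hind,
    Measure.prod_apply hset, hlaw, lintegral_unitExp (measurable_measure_prodMk_left hset)]
  have hsec : ∀ w : ℝ, (μ.map S) (Prod.mk w ⁻¹' {p : ℝ × ℝ | y ≤ p.1 + p.2}) =
      μ {ω | y - w ≤ S ω} := fun w => by
    rw [Measure.map_apply hS (measurable_prodMk_left hset)]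
    congr 1
    ext ω
    simp [add_comm]
  simp_rw [hsec]
  rw [← Set.Ioo_union_Ici_eq_Ioi hy, lintegral_union measurableSet_Ici
    (Set.disjoint_left.2 fun w hw hw' => not_le.2 hw.2 hw')]
  have h2 : ∀ w ∈ Set.Ioo 0 y, ENNReal.ofReal (Real.exp (-w)) * μ {ω | y - w ≤ S ω} =
      ENNReal.ofReal (Real.exp (-w) * gammaTail k (y - w)) := fun w hw => by
    rw [htail _ (sub_pos.2 hw.2), ENNReal.ofReal_mul (Real.exp_nonneg _)]
  have h3 : ∀ w ∈ Set.Ici y, ENNReal.ofReal (Real.exp (-w)) * μ {ω | y - w ≤ S ω} =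
      ENNReal.ofReal (Real.exp (-w)) := fun w hw => by
    have : {ω | y - w ≤ S ω} = Set.univ :=
      Set.eq_univ_of_forall fun ω => (sub_nonpos.2 hw).trans (hS0 ω)
    rw [this, measure_univ, mul_one]
  have hc : Continuous fun w => Real.exp (-w) * gammaTail k (y - w) :=
    (by fun_prop : Continuous fun w : ℝ => Real.exp (-w)).mul
      ((continuous_gammaTail k).comp (by fun_prop))
  have h4 : ∫ w in Set.Ioo 0 y, Real.exp (-w) * gammaTail k (y - w) =
      gammaTail (k + 1) y - Real.exp (-y) := by
    rw [← integral_Ioc_eq_integral_Ioo, ← intervalIntegral.integral_of_le hy.le,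
      integral_exp_neg_mul_gammaTail]
  have h5 : 0 ≤ᵐ[volume.restrict (Set.Ioo 0 y)] fun w => Real.exp (-w) * gammaTail k (y - w) := by
    filter_upwards [ae_restrict_mem measurableSet_Ioo] with w hw
    exact mul_nonneg (Real.exp_nonneg _) (gammaTail_nonneg k (sub_nonneg.2 hw.2.le))
  rw [setLIntegral_congr_fun measurableSet_Ioo h2, setLIntegral_congr_fun measurableSet_Ici h3,
    ← ofReal_integral_eq_lintegral_ofReal (hc.integrableOn_Icc.mono_set Set.Ioo_subset_Icc_self) h5,
    ← ofReal_integral_eq_lintegral_ofReal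
      (Iff.mpr integrableOn_Ici_iff_integrableOn_Ioi (integrableOn_exp_neg_Ioi y))
      (Filter.Eventually.of_forall fun w => Real.exp_nonneg _),
    ← ENNReal.ofReal_add (integral_nonneg_of_ae h5) (integral_nonneg fun w => Real.exp_nonneg _),
    h4, integral_Ici_eq_integral_Ioi, integral_exp_neg_Ioi, sub_add_cancel]

lemma measure_le_sum_of_iIndepFun {ι : Type*} {W : ι → Ω → ℝ} (hW : ∀ i, Measurable (W i))
    (hlaw : ∀ i, μ.map (W i) = unitExp) (hind : iIndepFun W μ) (hW0 : ∀ i ω, 0 ≤ W i ω)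
    (s : Finset ι) {y : ℝ} (hy : 0 < y) :
    μ {ω | y ≤ ∑ i ∈ s, W i ω} = ENNReal.ofReal (gammaTail s.card y) := by
  classical
  induction s using Finset.induction_on generalizing y with
  | empty => simp [gammaTail, hy.not_ge]
  | insert a s ha ih =>
    simp_rw [Finset.sum_insert ha]
    rw [Finset.card_insert_of_notMem ha]
    refine measure_le_add_of_indepFun (hW a) (Finset.measurable_fun_sum _ fun i _ => hW i) (hlaw a)
      ?_ (fun ω => Finset.sum_nonneg fun i _ => hW0 i ω) (fun y hy => ih hy) hy
    have := (iIndepFun.indepFun_finsetSum_of_notMem hind hW ha).symm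
    convert this using 1
    ext ω
    simp

end GammaTail

section Moments

lemma position_insert_of_lt {ψ : Finset ℕ} {l m : ℕ} (hl : l < m) :
    position (insert m ψ) l = position ψ l := by
  rw [position, position, Finset.filter_insert, if_neg (by omega)]

lemma position_insert_self {ψ : Finset ℕ} {m : ℕ} (hψ : ∀ l ∈ ψ, l < m) :
    position (insert m ψ) m = ψ.card + 1 := by
  rw [position, Finset.filter_true_of_mem, Finset.card_insert_of_notMem fun h => (hψ m h).false]
  intro l hl
  rcases Finset.mem_insert.1 hl with rfl | h
  · exact le_rfl
  · exact (hψ l h).le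

lemma Upsilon_self (δ : ℝ) (m : ℕ) : Upsilon δ m m = 1 := by
  simp [Upsilon]

/-- For `1 ≤ m`, no subset of `{1, …, m-1}` has `m` elements. -/
lemma Upsilon_zero_right (δ : ℝ) {m : ℕ} (hm : 1 ≤ m) : Upsilon δ m 0 = 0 := by
  rw [Upsilon, Finset.powersetCard_eq_empty.2 (by simp; omega), Finset.sum_empty]

/-- Splitting the subsets of `{1, …, m}` according to whether they contain `m`. -/
lemma Upsilon_succ (δ : ℝ) {m n : ℕ} (hn : 1 ≤ n) (hnm : n ≤ m) :
    Upsilon δ (m + 1) n = Upsilon δ m (n - 1) + (m - δ * n) * Upsilon δ m n := by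
  have hm : 1 ≤ m := hn.trans hnm
  have hI : Finset.Icc 1 (m + 1 - 1) = insert m (Finset.Icc 1 (m - 1)) := by
    ext l
    simp only [Finset.mem_Icc, Finset.mem_insert]
    omega
  have hnot : m ∉ Finset.Icc 1 (m - 1) := by
    simp only [Finset.mem_Icc]
    omega
  have hlt : ∀ {k : ℕ} {ψ : Finset ℕ}, ψ ∈ (Finset.Icc 1 (m - 1)).powersetCard k →
      ∀ l ∈ ψ, l < m := fun hψ l hl => by
    have := Finset.mem_Icc.1 ((Finset.mem_powersetCard.1 hψ).1 hl)
    omega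
  rw [Upsilon, hI, show m + 1 - n = (m - n) + 1 by omega, Finset.powersetCard_succ_insert hnot,
    Finset.sum_union, Finset.sum_image]
  · congr 1
    · rw [Upsilon, show m - (n - 1) = m - n + 1 by omega]
    · rw [Upsilon, Finset.mul_sum]
      refine Finset.sum_congr rfl fun ψ hψ => ?_
      rw [Finset.prod_insert fun h => (hlt hψ m h).false, position_insert_self (hlt hψ),
        (Finset.mem_powersetCard.1 hψ).2]
      congr 1
      · push_cast [Nat.cast_sub hnm]
        ring
      · exact Finset.prod_congr rfl fun l hl => by rw [position_insert_of_lt (hlt hψ l hl)]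
  · intro ψ hψ ψ' hψ' h
    have h1 : m ∉ ψ := fun h => (hlt hψ m h).false
    have h2 : m ∉ ψ' := fun h => (hlt hψ' m h).false
    rw [← Finset.erase_insert h1, ← Finset.erase_insert h2, h]
  · rw [Finset.disjoint_left]
    rintro ψ hψ hψ'
    obtain ⟨ψ', -, rfl⟩ := Finset.mem_image.1 hψ'
    exact (hlt hψ m (Finset.mem_insert_self _ _)).false

/-- The polynomial `∑ₙ (δ x)ⁿ Υ_{m,n}` in `x`. -/
def upsilonPoly (δ : ℝ) (m : ℕ) (x : ℝ) : ℝ :=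
  ∑ n ∈ Finset.range (m + 1), (δ * x) ^ n * Upsilon δ m n

/-- The derivative of `upsilonPoly`, multiplied by `x`. -/
def upsilonPolyEuler (δ : ℝ) (m : ℕ) (x : ℝ) : ℝ :=
  ∑ n ∈ Finset.range (m + 1), n * ((δ * x) ^ n * Upsilon δ m n)

lemma upsilonPoly_zero (δ x : ℝ) : upsilonPoly δ 0 x = 1 := by
  simp [upsilonPoly, Upsilon_self]

lemma upsilonPoly_eq_sum_Icc (δ x : ℝ) {m : ℕ} (hm : 1 ≤ m) :
    upsilonPoly δ m x = ∑ n ∈ Finset.Icc 1 m, (δ * x) ^ n * Upsilon δ m n := by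
  rw [upsilonPoly, Finset.range_eq_Ico, Finset.sum_eq_sum_Ico_succ_bot (by omega),
    Upsilon_zero_right δ hm, mul_zero, zero_add]
  rfl

lemma upsilonPoly_succ (δ x : ℝ) (m : ℕ) :
    upsilonPoly δ (m + 1) x =
      (m + δ * x) * upsilonPoly δ m x - δ * upsilonPolyEuler δ m x := by
  rcases Nat.eq_zero_or_pos m with rfl | hm
  · simp [upsilonPoly, upsilonPolyEuler, Finset.sum_range_succ, Upsilon_self,
      Upsilon_zero_right δ le_rfl]
  have h1 : ∀ n ∈ Finset.range m, (δ * x) ^ (n + 1) * Upsilon δ (m + 1) (n + 1) =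
      δ * x * ((δ * x) ^ n * Upsilon δ m n) +
        (m - δ * (n + 1 : ℕ)) * ((δ * x) ^ (n + 1) * Upsilon δ m (n + 1)) := fun n hn => by
    rw [Upsilon_succ δ (by omega) (by have := Finset.mem_range.1 hn; omega), Nat.add_sub_cancel]
    ring
  have h2 : ∑ n ∈ Finset.range m,
        (m - δ * (n + 1 : ℕ)) * ((δ * x) ^ (n + 1) * Upsilon δ m (n + 1)) =
      m * upsilonPoly δ m x - δ * upsilonPolyEuler δ m x := by
    rw [upsilonPoly, upsilonPolyEuler, Finset.mul_sum, Finset.mul_sum, ← Finset.sum_sub_distrib,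
      Finset.sum_range_succ', Upsilon_zero_right δ hm]
    simp only [mul_zero, sub_zero, add_zero]
    exact Finset.sum_congr rfl fun n _ => by ring
  rw [upsilonPoly, Finset.sum_range_succ', Upsilon_zero_right δ (by omega), Finset.sum_range_succ,
    Finset.sum_congr rfl h1, Finset.sum_add_distrib, h2, ← Finset.mul_sum, Upsilon_self]
  have h3 : upsilonPoly δ m x =
      ∑ n ∈ Finset.range m, (δ * x) ^ n * Upsilon δ m n + (δ * x) ^ m := by
    rw [upsilonPoly, Finset.sum_range_succ, Upsilon_self, mul_one]
  rw [add_mul, h3]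
  ring

lemma hasDerivAt_upsilonPoly_mul_rpow (δ c : ℝ) (m : ℕ) {t : ℝ} (ht : 0 < t) :
    HasDerivAt (fun s => upsilonPoly δ m (c * s ^ δ))
      (δ / t * upsilonPolyEuler δ m (c * t ^ δ)) t := by
  have h0 : HasDerivAt (fun s : ℝ => c * s ^ δ) (c * (δ * t ^ (δ - 1))) t :=
    (Real.hasDerivAt_rpow_const (Or.inl ht.ne')).const_mul c
  have h1 : ∀ n ∈ Finset.range (m + 1),
      HasDerivAt (fun s : ℝ => (δ * (c * s ^ δ)) ^ n * Upsilon δ m n)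
        (δ / t * (n * ((δ * (c * t ^ δ)) ^ n * Upsilon δ m n))) t := fun n _ => by
    refine (((h0.const_mul δ).pow n).mul_const (Upsilon δ m n)).congr_deriv ?_
    rcases Nat.eq_zero_or_pos n with rfl | hn
    · simp
    obtain ⟨n, rfl⟩ := Nat.exists_eq_add_of_le' hn
    rw [Real.rpow_sub_one ht.ne', Nat.add_sub_cancel]
    field_simp
    ring
  have h2 := HasDerivAt.fun_sum h1
  rw [← Finset.mul_sum] at h2
  exact h2

variable {Ω : Type*} [MeasurableSpace Ω] {μ : Measure Ω}

/-- The exponentially weighted moments of a nonnegative random variable with Laplace transform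
`t ↦ exp (-c t^δ)`. -/
theorem integral_pow_mul_exp_neg_of_laplace [IsFiniteMeasure μ] {I : Ω → ℝ} (hI : AEMeasurable I μ)
    (hI0 : ∀ ω, 0 ≤ I ω) {δ c : ℝ}
    (hL : ∀ t, 0 < t → ∫ ω, Real.exp (-t * I ω) ∂μ = Real.exp (-(c * t ^ δ))) (m : ℕ) {t : ℝ}
    (ht : 0 < t) :
    ∫ ω, (t * I ω) ^ m * Real.exp (-t * I ω) ∂μ =
      Real.exp (-(c * t ^ δ)) * upsilonPoly δ m (c * t ^ δ) := by
  have hset : Set.Iio (0 : ℝ) ⊆ interior (integrableExpSet I μ) := by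
    refine interior_maximal (fun s hs => ?_) isOpen_Iio
    have hs' : s < 0 := hs
    refine Integrable.of_bound (C := 1) (by fun_prop) (Filter.Eventually.of_forall fun ω => ?_)
    rw [Real.norm_eq_abs, Real.abs_exp, Real.exp_le_one_iff]
    exact mul_nonpos_of_nonpos_of_nonneg hs'.le (hI0 ω)
  have key : ∀ (m : ℕ) (t : ℝ), 0 < t → ∫ ω, I ω ^ m * Real.exp (-t * I ω) ∂μ =
      (t ^ m)⁻¹ * (Real.exp (-(c * t ^ δ)) * upsilonPoly δ m (c * t ^ δ)) := by
    intro m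
    induction m with
    | zero =>
      intro t ht
      simpa [upsilonPoly_zero] using hL t ht
    | succ m ih =>
      intro t ht
      have h1 : HasDerivAt (fun s => ∫ ω, I ω ^ m * Real.exp (-s * I ω) ∂μ)
          (-∫ ω, I ω ^ (m + 1) * Real.exp (-t * I ω) ∂μ) t := by
        have := hasDerivAt_integral_pow_mul_exp_real (X := I) (μ := μ) (t := -t)
          (hset (by simpa using ht)) m
        simpa [Function.comp_def] using this.scomp t (hasDerivAt_neg t)
      have h0 : HasDerivAt (fun s : ℝ => c * s ^ δ) (c * (δ * t ^ (δ - 1))) t :=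
        (Real.hasDerivAt_rpow_const (Or.inl ht.ne')).const_mul c
      have h2 := ((hasDerivAt_pow m t).inv (pow_ne_zero m ht.ne')).mul
        (h0.neg.exp.mul (hasDerivAt_upsilonPoly_mul_rpow δ c m ht))
      have h3 := h1.congr_of_eventuallyEq (f₁ := fun s => (s ^ m)⁻¹ *
          (Real.exp (-(c * s ^ δ)) * upsilonPoly δ m (c * s ^ δ))) (by
        filter_upwards [Ioi_mem_nhds ht] with s hs
        exact (ih s hs).symm)
      have h4 := neg_eq_iff_eq_neg.1 (h3.unique h2)
      rw [h4, upsilonPoly_succ, Real.rpow_sub_one ht.ne']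
      simp only [Pi.inv_apply, Pi.mul_apply, Pi.neg_apply]
      rcases Nat.eq_zero_or_pos m with rfl | hm
      · simp
        field_simp
        ring
      obtain ⟨m, rfl⟩ := Nat.exists_eq_add_of_le' hm
      rw [Nat.add_sub_cancel]
      push_cast
      field_simp
      ring
  simp_rw [mul_pow, mul_assoc]
  rw [integral_const_mul, key m t ht, mul_inv_cancel_left₀ (by positivity)]

end Moments

section Independence

variable {Ω : Type*} [MeasurableSpace Ω] {μ : Measure Ω}

lemma indepFun_of_iIndepFun_sumElim {ι κ E : Type*} [MeasurableSpace E]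
    {f : ι → Ω → E} {g : κ → Ω → E} (hf : ∀ i, Measurable (f i)) (hg : ∀ i, Measurable (g i))
    (h : iIndepFun (fun i : ι ⊕ κ => Sum.elim f g i) μ) :
    IndepFun (fun ω i => f i ω) (fun ω i => g i ω) μ := by
  have h1 := indep_iSup_of_disjoint (m := fun i : ι ⊕ κ =>
      MeasurableSpace.comap (Sum.elim f g i) inferInstance)
    (by
      rintro (i | i)
      · exact (hf i).comap_le
      · exact (hg i).comap_le) h (S := Set.range Sum.inl) (T := Set.range Sum.inr)
    (by
      rw [Set.disjoint_left]
      rintro _ ⟨i, rfl⟩ ⟨j, hj⟩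
      exact absurd hj (by simp))
  refine indep_of_indep_of_le_right (indep_of_indep_of_le_left h1 ?_) ?_
  · simp only [MeasurableSpace.pi, MeasurableSpace.comap_iSup, MeasurableSpace.comap_comp]
    exact iSup_le fun i => le_iSup₂_of_le (Sum.inl i) ⟨i, rfl⟩ le_rfl
  · simp only [MeasurableSpace.pi, MeasurableSpace.comap_iSup, MeasurableSpace.comap_comp]
    exact iSup_le fun i => le_iSup₂_of_le (Sum.inr i) ⟨i, rfl⟩ le_rfl

lemma indepFun_prodMk_assoc [IsProbabilityMeasure μ] {E F G : Type*} [MeasurableSpace E]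
    [MeasurableSpace F] [MeasurableSpace G]
    {A : Ω → E} {B : Ω → F} {C : Ω → G} (hA : Measurable A) (hB : Measurable B) (hC : Measurable C)
    (hAB : IndepFun A B μ) (hABC : IndepFun (fun ω => (A ω, B ω)) C μ) :
    IndepFun A (fun ω => (B ω, C ω)) μ := by
  have hBC : IndepFun B C μ := hABC.comp measurable_snd measurable_id
  have := Measure.isProbabilityMeasure_map (μ := μ) hA.aemeasurable
  have := Measure.isProbabilityMeasure_map (μ := μ) hB.aemeasurable
  have := Measure.isProbabilityMeasure_map (μ := μ) hC.aemeasurable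
  rw [indepFun_iff_map_prod_eq_prod_map_map (by fun_prop) (by fun_prop)] at *
  rw [hBC, ← Measure.prodAssoc_prod, ← hAB, ← hABC, Measure.map_map (by fun_prop) (by fun_prop)]
  rfl

end Independence

section Network

variable {Ω : Type*} [MeasurableSpace Ω] {μ : Measure Ω} {M : ℕ}
  {hA : Fin M → Ω → ℂ} {X : ℕ → Ω → Plane} {hJ : ℕ → Ω → ℂ} {lam : ℝ≥0}

lemma measurable_interference (α PJ : ℝ) :
    Measurable fun p : (ℕ → ℂ) × (ℕ → Plane) => interference α PJ p.2 p.1 :=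
  Measurable.tsum fun j => by fun_prop

lemma IsNetwork.indepFun_interferers (hnet : IsNetwork μ hA X hJ lam) :
    IndepFun (fun ω j => hJ j ω) (fun ω j => X j ω) μ :=
  hnet.indep_locations.comp (φ := fun (f : Fin M ⊕ ℕ → ℂ) j => f (Sum.inr j)) (by fun_prop)
    measurable_id

lemma IsNetwork.measurable_interference (hnet : IsNetwork μ hA X hJ lam) (α PJ : ℝ) :
    Measurable fun ω => interference α PJ (fun j => X j ω) (fun j => hJ j ω) := by
  have h2 := hnet.measurable_hJ
  have h3 := hnet.poisson.measurable
  exact (CAS.measurable_interference α PJ).comp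
    (g := fun p : (ℕ → ℂ) × (ℕ → Plane) => interference α PJ p.2 p.1)
    (f := fun ω => ((fun j => hJ j ω), (fun j => X j ω))) (by fun_prop)

variable [IsProbabilityMeasure μ]

lemma IsNetwork.indepFun_signal (hnet : IsNetwork μ hA X hJ lam) :
    IndepFun (fun ω m => hA m ω) (fun ω => ((fun j => hJ j ω), (fun j => X j ω))) μ := by
  have h1 := hnet.measurable_hA
  have h2 := hnet.measurable_hJ
  have h3 := hnet.poisson.measurable
  refine indepFun_prodMk_assoc (by fun_prop) (by fun_prop) (by fun_prop)
    (indepFun_of_iIndepFun_sumElim h1 h2 hnet.indep_fading) ?_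
  exact hnet.indep_locations.comp
    (φ := fun (f : Fin M ⊕ ℕ → ℂ) => ((fun m => f (Sum.inl m)), (fun j => f (Sum.inr j))))
    (by fun_prop) measurable_id

/-- The Laplace transform of the aggregate interference. -/
theorem IsNetwork.lintegral_expNeg_interference (hnet : IsNetwork μ hA X hJ lam) {α PJ t : ℝ}
    (hα : 2 < α) (hPJ : 0 < PJ) (ht : 0 < t) :
    ∫⁻ ω, expNeg (ENNReal.ofReal t * interference α PJ (fun j => X j ω) (fun j => hJ j ω)) ∂μ =
      expNeg (ENNReal.ofReal (kappa (2 / α) * lam * PJ ^ (2 / α) * t ^ (2 / α))) := by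
  have h2 := hnet.measurable_hJ
  have h3 := hnet.poisson.measurable
  have hmJ : Measurable fun ω j => hJ j ω := by fun_prop
  have hmX : Measurable fun ω j => X j ω := by fun_prop
  have := Measure.isProbabilityMeasure_map (μ := μ) hmJ.aemeasurable
  have := Measure.isProbabilityMeasure_map (μ := μ) hmX.aemeasurable
  have hF : Measurable fun p : (ℕ → ℂ) × (ℕ → Plane) =>
      expNeg (ENNReal.ofReal t * interference α PJ p.2 p.1) :=
    measurable_expNeg.comp ((CAS.measurable_interference α PJ).const_mul _)
  have hI : iIndepFun hJ μ := hnet.indep_fading.precomp (g := Sum.inr) Sum.inr_injective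
  have hstep : ∀ x : ℕ → Plane,
      ∫⁻ h, expNeg (ENNReal.ofReal t * interference α PJ x h) ∂(μ.map fun ω j => hJ j ω) =
        expNeg (∑' j, ENNReal.ofReal (Real.log (1 + t * PJ * ‖x j‖ ^ (-α)))) := fun x => by
    have hFx : Measurable fun h => expNeg (ENNReal.ofReal t * interference α PJ x h) :=
      hF.comp (f := fun h : ℕ → ℂ => (h, x)) (by fun_prop)
    rw [lintegral_map hFx hmJ,
      ← lintegral_expNeg_tsum_norm_sq h2 hnet.law_hJ hI (fun j => by positivity)]
    refine lintegral_congr fun ω => ?_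
    rw [interference, ← ENNReal.tsum_mul_left]
    congr 1
    refine tsum_congr fun j => ?_
    rw [← ENNReal.ofReal_mul ht.le]
    congr 1
    ring
  have hlog : Measurable fun x : Plane => ENNReal.ofReal (Real.log (1 + t * PJ * ‖x‖ ^ (-α))) := by
    fun_prop
  calc _ = ∫⁻ p, expNeg (ENNReal.ofReal t * interference α PJ p.2 p.1)
        ∂(μ.map fun ω => ((fun j => hJ j ω), (fun j => X j ω))) := by
        rw [lintegral_map hF (by fun_prop)]
    _ = ∫⁻ x, expNeg (∑' j, ENNReal.ofReal (Real.log (1 + t * PJ * ‖x j‖ ^ (-α))))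
        ∂(μ.map fun ω j => X j ω) := by
        rw [(indepFun_iff_map_prod_eq_prod_map_map hmJ.aemeasurable hmX.aemeasurable).1
          hnet.indepFun_interferers, lintegral_prod_symm _ hF.aemeasurable]
        exact lintegral_congr hstep
    _ = ∫⁻ ω, expNeg (∑' j, ENNReal.ofReal (Real.log (1 + t * PJ * ‖X j ω‖ ^ (-α)))) ∂μ :=
        lintegral_map (measurable_expNeg.comp
          (Measurable.tsum fun j => hlog.comp (measurable_pi_apply j))) hmX
    _ = _ := by
        rw [hnet.poisson.lintegral_expNeg_tsum hlog, lintegral_smul_measure,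
          lintegral_path_loss hα (mul_pos ht hPJ), ENNReal.smul_def, smul_eq_mul,
          ← ENNReal.ofReal_coe_nnreal, ← ENNReal.ofReal_mul lam.coe_nonneg,
          Real.mul_rpow ht.le hPJ.le]
        congr 2
        ring

lemma ae_of_forall_ofReal_le_measure {p : Ω → Prop} {u : ℝ → ℝ}
    (hu : Filter.Tendsto u (nhdsWithin 0 (Set.Ioi 0)) (nhds 1))
    (h : ∀ t, 0 < t → ENNReal.ofReal (u t) ≤ μ {ω | p ω}) (hp : MeasurableSet {ω | p ω}) :
    ∀ᵐ ω ∂μ, p ω := by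
  have h1 : 1 ≤ μ {ω | p ω} := by
    have h2 := ENNReal.tendsto_ofReal hu
    rw [ENNReal.ofReal_one] at h2
    refine le_of_tendsto h2 ?_
    filter_upwards [self_mem_nhdsWithin] with t ht using h t ht
  exact (mem_ae_iff_prob_eq_one hp).2 (le_antisymm prob_le_one h1)

lemma kappa_pos {δ : ℝ} (hδ0 : 0 < δ) (hδ1 : δ < 1) : 0 < kappa δ :=
  mul_pos (mul_pos Real.pi_pos (Real.Gamma_pos_of_pos (by linarith)))
    (Real.Gamma_pos_of_pos (by linarith))

lemma IsNetwork.ae_interference_ne_top (hnet : IsNetwork μ hA X hJ lam) {α PJ : ℝ}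
    (hα : 2 < α) (hPJ : 0 < PJ) :
    ∀ᵐ ω ∂μ, interference α PJ (fun j => X j ω) (fun j => hJ j ω) ≠ ∞ := by
  have hm := hnet.measurable_interference α PJ
  have hδ0 : 0 < 2 / α := by positivity
  have hδ1 : 2 / α < 1 := (div_lt_one (by linarith)).2 hα
  have hset : MeasurableSet {ω | interference α PJ (fun j => X j ω) (fun j => hJ j ω) ≠ ∞} :=
    (hm (measurableSet_singleton ∞)).compl
  refine ae_of_forall_ofReal_le_measure
    (u := fun t => Real.exp (-(kappa (2 / α) * lam * PJ ^ (2 / α) * t ^ (2 / α))))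
    ?_ (fun t ht => ?_) hset
  · have hc : Continuous fun t : ℝ =>
        Real.exp (-(kappa (2 / α) * lam * PJ ^ (2 / α) * t ^ (2 / α))) := by
      have := Real.continuous_rpow_const hδ0.le
      fun_prop
    have := hc.tendsto 0
    rw [Real.zero_rpow hδ0.ne', mul_zero, neg_zero, Real.exp_zero] at this
    exact this.mono_left nhdsWithin_le_nhds
  · have := kappa_pos hδ0 hδ1
    rw [← expNeg_ofReal (by positivity), ← hnet.lintegral_expNeg_interference hα hPJ ht,
      ← lintegral_indicator_one hset]
    refine lintegral_mono fun ω => ?_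
    by_cases h : interference α PJ (fun j => X j ω) (fun j => hJ j ω) = ∞
    · simp [h, ht]
    · rw [Set.indicator_of_mem (by exact h)]
      exact expNeg_le_one _

lemma IsNetwork.measure_le_sum_norm_sq (hnet : IsNetwork μ hA X hJ lam) {y : ℝ} (hy : 0 < y) :
    μ {ω | y ≤ ∑ m, ‖hA m ω‖ ^ 2} = ENNReal.ofReal (gammaTail M y) := by
  have hsq : Measurable fun z : ℂ => ‖z‖ ^ 2 := by fun_prop
  have hI : iIndepFun hA μ := hnet.indep_fading.precomp (g := Sum.inl) Sum.inl_injective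
  have h := measure_le_sum_of_iIndepFun (μ := μ) (W := fun m ω => ‖hA m ω‖ ^ 2)
    (fun m => hsq.comp (hnet.measurable_hA m))
    (fun m => by
      rw [← map_norm_sq_complexGaussian, ← (hnet.law_hA m).map_eq,
        Measure.map_map hsq (hnet.measurable_hA m)]
      rfl)
    (hI.comp (fun _ z => ‖z‖ ^ 2) fun _ => hsq) (fun m ω => by positivity) Finset.univ hy
  simpa using h

lemma IsNetwork.ae_sum_norm_sq_pos (hnet : IsNetwork μ hA X hJ lam) (hM : 1 ≤ M) :
    ∀ᵐ ω ∂μ, 0 < ∑ m, ‖hA m ω‖ ^ 2 := by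
  have h1 := hnet.measurable_hA
  refine ae_of_forall_ofReal_le_measure (u := gammaTail M) ?_ (fun t ht => ?_)
    (measurableSet_lt measurable_const (by fun_prop))
  · rw [← gammaTail_zero hM]
    exact ((continuous_gammaTail M).tendsto 0).mono_left nhdsWithin_le_nhds
  · rw [← hnet.measure_le_sum_norm_sq ht]
    exact measure_mono fun ω hω => ht.trans_le hω

/-- Maximal ratio transmission adds up the channel gains. -/
lemma signalPower_mrtWeight {α PA : ℝ} (hPA : 0 ≤ PA) (La : Plane) (h : Fin M → ℂ) :
    signalPower α (fun _ => PA) (fun _ => La) (mrtWeight h) h =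
      PA * ‖La‖ ^ (-α) * ∑ m, ‖h m‖ ^ 2 := by
  have hn : ‖WithLp.toLp 2 h‖ ^ 2 = ∑ m, ‖h m‖ ^ 2 := EuclideanSpace.norm_sq_eq _
  set N := ‖WithLp.toLp 2 h‖ with hN
  have hN0 : 0 ≤ N := norm_nonneg _
  have hsum : ∑ m, ((√PA : ℝ) : ℂ) * mrtWeight h m * h m * ((‖La‖ ^ (-α / 2) : ℝ) : ℂ) =
      ((√PA * ‖La‖ ^ (-α / 2) * N : ℝ) : ℂ) := by
    have e : ∀ m, ((√PA : ℝ) : ℂ) * mrtWeight h m * h m * ((‖La‖ ^ (-α / 2) : ℝ) : ℂ) =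
        ((√PA * ‖La‖ ^ (-α / 2) / N * ‖h m‖ ^ 2 : ℝ) : ℂ) := fun m => by
      have := Complex.conj_mul' (h m)
      rw [mrtWeight, ← hN]
      push_cast
      rw [← this]
      ring
    simp_rw [e]
    rw [← Complex.ofReal_sum, ← Finset.mul_sum, ← hn]
    rcases hN0.eq_or_lt with h0 | h0
    · simp [← h0]
    · congr 1
      field_simp
  rw [signalPower, hsum, Complex.norm_real, Real.norm_eq_abs, sq_abs, mul_pow, mul_pow,
    Real.sq_sqrt hPA, hn, ← Real.rpow_natCast (‖La‖ ^ (-α / 2)), ← Real.rpow_mul (norm_nonneg _)]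
  congr 3
  push_cast
  ring

lemma measure_mul_le_of_indepFun {G I : Ω → ℝ} (hG : Measurable G) (hI : Measurable I)
    (hind : IndepFun I G μ) {q : ℝ → ℝ≥0∞} (hq : ∀ y, 0 ≤ y → μ {ω | y ≤ G ω} = q y)
    (hI0 : ∀ ω, 0 ≤ I ω) {t : ℝ} (ht : 0 ≤ t) :
    μ {ω | t * I ω ≤ G ω} = ∫⁻ ω, q (t * I ω) ∂μ := by
  have hset : MeasurableSet {p : ℝ × ℝ | t * p.1 ≤ p.2} :=
    measurableSet_le (by fun_prop) measurable_snd
  have := Measure.isProbabilityMeasure_map (μ := μ) hG.aemeasurable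
  have := Measure.isProbabilityMeasure_map (μ := μ) hI.aemeasurable
  have h1 : μ {ω | t * I ω ≤ G ω} = (μ.map fun ω => (I ω, G ω)) {p : ℝ × ℝ | t * p.1 ≤ p.2} := by
    rw [Measure.map_apply (hI.prodMk hG) hset]
    rfl
  rw [h1, (indepFun_iff_map_prod_eq_prod_map_map hI.aemeasurable hG.aemeasurable).1 hind,
    Measure.prod_apply hset, lintegral_map (measurable_measure_prodMk_left hset) hI]
  refine lintegral_congr fun ω => ?_
  rw [← hq _ (mul_nonneg ht (hI0 ω)), Measure.map_apply hG (measurable_prodMk_left hset)]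
  rfl

/-- Averaging the Gamma tail over a nonnegative random variable with Laplace transform
`t ↦ exp (-c t^δ)`. -/
lemma integral_gammaTail_of_laplace {I : Ω → ℝ} (hI : Measurable I) (hI0 : ∀ ω, 0 ≤ I ω) {δ c : ℝ}
    (hL : ∀ t, 0 < t → ∫ ω, Real.exp (-t * I ω) ∂μ = Real.exp (-(c * t ^ δ)))
    {t : ℝ} (ht : 0 < t) (k : ℕ) :
    ∫ ω, gammaTail k (t * I ω) ∂μ =
      ∑ m ∈ Finset.range k, 1 / (m.factorial : ℝ) *
        (Real.exp (-(c * t ^ δ)) * upsilonPoly δ m (c * t ^ δ)) := by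
  have e : ∀ ω, gammaTail k (t * I ω) = ∑ m ∈ Finset.range k,
      1 / (m.factorial : ℝ) * ((t * I ω) ^ m * Real.exp (-t * I ω)) := fun ω => by
    rw [gammaTail, Finset.mul_sum, neg_mul]
    exact Finset.sum_congr rfl fun m _ => by ring
  simp_rw [e]
  rw [integral_finsetSum]
  · refine Finset.sum_congr rfl fun m _ => ?_
    rw [integral_const_mul, integral_pow_mul_exp_neg_of_laplace hI.aemeasurable hI0 hL m ht]
  · intro m _
    refine Integrable.of_bound (C := 1) (by fun_prop) (Filter.Eventually.of_forall fun ω => ?_)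
    have h0 : 0 ≤ t * I ω := mul_nonneg ht.le (hI0 ω)
    rw [Real.norm_of_nonneg (by positivity), neg_mul, Real.exp_neg, ← mul_assoc,
      mul_inv_le_iff₀ (Real.exp_pos _), one_mul]
    have := Real.pow_div_factorial_le_exp _ h0 m
    rwa [one_div, inv_mul_eq_div]

end Network

end CAS

end

theorem mainTheorem2 {Ω : Type*} [MeasurableSpace Ω] (μ : Measure Ω) [IsProbabilityMeasure μ]
    (M : ℕ) (hM : 1 ≤ M)
    (hA : Fin M → Ω → ℂ) (X : ℕ → Ω → CAS.Plane) (hJ : ℕ → Ω → ℂ)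
    (lam : ℝ≥0) (hlam : 0 < lam)
    (hnet : CAS.IsNetwork μ hA X hJ lam)
    (α PA PJ β : ℝ) (hα : 2 < α) (hPA : 0 < PA) (hPJ : 0 < PJ) (hβ : 0 ≤ β)
    (La : CAS.Plane) (hLa : La ≠ 0)
    (δ φ : ℝ) (hδ : δ = 2 / α) (hφ : φ = CAS.phi δ lam PJ PA ‖La‖) :
    CAS.connectivityProbability μ hA X hJ α PA PJ La 0 β =
      Real.exp (-(φ * β ^ δ)) +
        Real.exp (-(φ * β ^ δ)) *
          ∑ m ∈ Finset.Icc 1 (M - 1), 1 / (m.factorial : ℝ) *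
            ∑ n ∈ Finset.Icc 1 m, (δ * φ * β ^ δ) ^ n * CAS.Upsilon δ m n := by
  have hα0 : 0 < α := by linarith
  have hδ0 : 0 < δ := hδ ▸ div_pos two_pos hα0
  have hδ1 : δ < 1 := hδ ▸ (div_lt_one hα0).2 hα
  rcases hβ.eq_or_lt with rfl | hβ
  · have hzero : ∀ m : ℕ, ∑ n ∈ Finset.Icc 1 m, (0 : ℝ) ^ n * CAS.Upsilon δ m n = 0 := fun m =>
      Finset.sum_eq_zero fun n hn => by
        rw [zero_pow (by have := Finset.mem_Icc.1 hn; omega), zero_mul]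
    simp [CAS.connectivityProbability, Real.zero_rpow hδ0.ne', hzero]
  have hr : 0 < ‖La‖ := norm_pos_iff.2 hLa
  have hmA := hnet.measurable_hA
  set G : Ω → ℝ := fun ω => ∑ m, ‖hA m ω‖ ^ 2 with hG
  set I : Ω → ℝ := fun ω =>
    (CAS.interference α PJ (fun j => X j ω) (fun j => hJ j ω)).toReal with hI
  have hGm : Measurable G := by fun_prop
  have hIm : Measurable I := (hnet.measurable_interference α PJ).ennreal_toReal
  have hI0 : ∀ ω, 0 ≤ I ω := fun ω => ENNReal.toReal_nonneg
  have hfin := hnet.ae_interference_ne_top hα hPJ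
  have hrα : 0 < ‖La‖ ^ α := Real.rpow_pos_of_pos hr _
  set t : ℝ := β * ‖La‖ ^ α / PA with ht
  have ht0 : 0 < t := by positivity
  set c : ℝ := CAS.kappa δ * lam * PJ ^ δ with hc
  have hκ := CAS.kappa_pos hδ0 hδ1
  have hL : ∀ s, 0 < s → ∫ ω, Real.exp (-s * I ω) ∂μ = Real.exp (-(c * s ^ δ)) := by
    intro s hs
    have h1 := hnet.lintegral_expNeg_interference hα hPJ hs
    rw [← hδ, CAS.expNeg_ofReal (by positivity)] at h1
    rw [integral_eq_lintegral_of_nonneg_ae (Filter.Eventually.of_forall fun ω => Real.exp_nonneg _)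
      (by fun_prop), ← ENNReal.toReal_ofReal (Real.exp_nonneg (-(c * s ^ δ))), ← h1]
    congr 1
    refine lintegral_congr_ae ?_
    filter_upwards [hfin] with ω hω
    rw [CAS.expNeg_of_ne_top (ENNReal.mul_ne_top ENNReal.ofReal_ne_top hω), ENNReal.toReal_mul,
      ENNReal.toReal_ofReal hs.le, neg_mul]
  have hind : IndepFun I G μ := hnet.indepFun_signal.symm.comp
    (φ := fun p : (ℕ → ℂ) × (ℕ → CAS.Plane) => (CAS.interference α PJ p.2 p.1).toReal)
    (ψ := fun h : Fin M → ℂ => ∑ m, ‖h m‖ ^ 2)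
    (CAS.measurable_interference α PJ).ennreal_toReal (by fun_prop)
  have htail : ∀ y, 0 ≤ y → μ {ω | y ≤ G ω} = ENNReal.ofReal (CAS.gammaTail M y) := by
    intro y hy
    rcases hy.eq_or_lt with rfl | hy
    · have : {ω | 0 ≤ G ω} = Set.univ :=
        Set.eq_univ_of_forall fun ω =>
          Finset.sum_nonneg (f := fun m => ‖hA m ω‖ ^ 2) fun m _ => by positivity
      rw [this, CAS.gammaTail_zero hM, measure_univ, ENNReal.ofReal_one]
    · exact hnet.measure_le_sum_norm_sq hy
  have hevent : CAS.connectivityProbability μ hA X hJ α PA PJ La 0 β =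
      μ.real {ω | t * I ω ≤ G ω} := by
    refine measureReal_congr ?_
    filter_upwards [hfin, hnet.ae_sum_norm_sq_pos hM] with ω hω hGω
    refine propext ?_
    change ENNReal.ofReal β ≤ _ ↔ t * I ω ≤ G ω
    have hSpos : 0 < PA * ‖La‖ ^ (-α) * G ω :=
      mul_pos (mul_pos hPA (Real.rpow_pos_of_pos hr _)) hGω
    rw [CAS.sinr, CAS.signalPower_mrtWeight hPA.le, ENNReal.ofReal_zero, add_zero,
      ENNReal.le_div_iff_mul_le (Or.inr (by simpa using hSpos)) (Or.inr ENNReal.ofReal_ne_top),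
      ← ENNReal.ofReal_toReal hω, ← ENNReal.ofReal_mul hβ.le,
      ENNReal.ofReal_le_ofReal_iff hSpos.le]
    change β * I ω ≤ PA * ‖La‖ ^ (-α) * G ω ↔ _
    rw [ht, Real.rpow_neg hr.le, ← div_eq_mul_inv, div_mul_eq_mul_div, le_div_iff₀ hrα,
      div_mul_eq_mul_div, div_le_iff₀ hPA]
    ring_nf
  have hx : c * t ^ δ = φ * β ^ δ := by
    rw [hφ, CAS.phi, hc, ht, Real.div_rpow (by positivity) hPA.le, Real.mul_rpow hβ.le hrα.le,
      ← Real.rpow_mul hr.le, show α * δ = 2 by rw [hδ]; field_simp, Real.rpow_two]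
    ring
  rw [hevent, measureReal_def, CAS.measure_mul_le_of_indepFun hGm hIm hind htail hI0 ht0.le,
    ← integral_eq_lintegral_of_nonneg_ae
      (Filter.Eventually.of_forall fun ω => CAS.gammaTail_nonneg M (mul_nonneg ht0.le (hI0 ω)))
      ((CAS.continuous_gammaTail M).measurable.comp (hIm.const_mul t)).aestronglyMeasurable,
    CAS.integral_gammaTail_of_laplace hIm hI0 hL ht0, hx, Finset.range_eq_Ico,
    Finset.sum_eq_sum_Ico_succ_bot (by omega), CAS.upsilonPoly_zero]
  have hIcc : Finset.Ico (0 + 1) M = Finset.Icc 1 (M - 1) := by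
    ext m
    simp only [Finset.mem_Ico, Finset.mem_Icc]
    omega
  rw [hIcc, Finset.mul_sum]
  congr 1
  · simp
  · refine Finset.sum_congr rfl fun m hm => ?_
    rw [CAS.upsilonPoly_eq_sum_Icc δ _ (Finset.mem_Icc.1 hm).1, ← mul_assoc δ φ]
    ring
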